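/- Let $A$ be a ring with identity. Let $\mathrm{mod}\text{-}A$ be the category of finitely presented right $A$-modules, and let $\mathrm{mod}\text{-}(\mathrm{mod}\text{-}A)$ be the category of finitely presented functors $F:\mathrm{mod}\text{-}A\to\mathrm{Ab}$, that is, those for which there is a sequence of natural transformations $\mathrm{Hom}_A(Y,-)\to\mathrm{Hom}_A(X,-)\to F\to 0$ with $X,Y\in\mathrm{mod}\text{-}A$ that is exact at every object of $\mathrm{mod}\text{-}A$. Let $\mathbb{A}$ be the category with objects $A^n$ ($n\ge 0$) and $\mathrm{Hom}(A^n,A^m)=\mathrm{Mat}_{m\times n}(A)$, matrices acting from the left on column vectors. Let $\mathrm{III}(\mathbb{A})$ be Adelman's category: its objects are chains $X_1\xrightarrow{f_1}X_2\xrightarrow{f_2}X_3$ in $\mathbb{A}$ (with no condition on $f_2f_1$), and its morphisms are the commutative diagrams $(\alpha_1,\alpha_2,\alpha_3)$ from $(f_1,f_2)$ to $(g_1,g_2)$ modulo the null-homotopic ones, i.e. those with $\alpha_2=g_1s+tf_2$ for some $s:X_2\to Y_1$, $t:X_3\to Y_2$. Then there are mutually inverse additive equivalences $$\mathfrak{k}:\big(\mathrm{mod}\text{-}(\mathrm{mod}\text{-}A)\big)^{op}\to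 \mathrm{III}(\mathbb{A}),\qquad \mathfrak{k}^{-1}:\mathrm{III}(\mathbb{A})\to\big(\mathrm{mod}\text{-}(\mathrm{mod}\text{-}A)\big)^{op},$$ which are canonical in the sense that they commute, up to natural isomorphism, with the canonical functors from $A$ (as a category with a single object) given by $A\mapsto\mathrm{Hom}_A(A,-)$ and $A\mapsto(0\to A\to 0)$, such that the following hold. (1) Let $\mathrm{Hom}_A(Y,-)\xrightarrow{\mathrm{Hom}(f,-)}\mathrm{Hom}_A(X,-)\to F\to 0$ be a projective presentation of $F$, where $f:X\to Y$ is a morphism in $\mathrm{mod}\text{-}A$, and let $A^m\xrightarrow{a}A^n\xrightarrow{p}X\to 0$ and $A^k\xrightarrow{d}A^l\xrightarrow{q}Y\to 0$ be free presentations with matrices $b:A^m\to A^k$ and $c:A^n\to A^l$ such that $ca=db$ and $fp=qc$. Then $$\mathfrak{k}(F)\cong\Big(A^m\oplus A^k\xrightarrow{\begin{bmatrix}a&0\\ b&-1\end{bmatrix}}A^n\oplus A^k\xrightarrow{\begin{bmatrix}c&-d\end{bmatrix}}A^l\Big).$$ Every $F$ has such a projective presentation, and every $f$ has such a pair of free presentations.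 (2) Let $A^m\xrightarrow{u}A^n\xrightarrow{v}A^r$ be a chain, let $A^m\xrightarrow{u}A^n\xrightarrow{p}X\to 0$ and $A^m\xrightarrow{vu}A^r\xrightarrow{q}Y\to 0$ be exact with $X,Y\in\mathrm{mod}\text{-}A$, and let $f:X\to Y$ satisfy $fp=qv$. Then $F=\mathfrak{k}^{-1}(u,v)$ admits a projective presentation $\mathrm{Hom}_A(Y,-)\xrightarrow{\mathrm{Hom}(f,-)}\mathrm{Hom}_A(X,-)\to F\to 0$. Such $X$, $Y$ and $f$ exist for every chain. -/

import Mathlib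

open CategoryTheory Opposite

universe u v

noncomputable section

/-! ### Three-term chains and Adelman's category -/

/-- A three-term chain `X₁ ⟶ X₂ ⟶ X₃` (the composite need not vanish). -/
structure Chain3 (C : Type u) [Category.{v} C] where
  X₁ : C
  X₂ : C
  X₃ : C
  f₁ : X₁ ⟶ X₂
  f₂ : X₂ ⟶ X₃

namespace Chain3

variable {C : Type u} [Category.{v} C]

/-- A morphism of chains: a commutative diagram with the two chains as rows. -/
@[ext]
structure Hom (X Y : Chain3 C) where
  α₁ : X.X₁ ⟶ Y.X₁
  α₂ : X.X₂ ⟶ Y.X₂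
  α₃ : X.X₃ ⟶ Y.X₃
  comm₁ : X.f₁ ≫ α₂ = α₁ ≫ Y.f₁
  comm₂ : X.f₂ ≫ α₃ = α₂ ≫ Y.f₂

instance : Category (Chain3 C) where
  Hom X Y := Hom X Y
  id X := ⟨𝟙 _, 𝟙 _, 𝟙 _, by simp, by simp⟩
  comp φ ψ := ⟨φ.α₁ ≫ ψ.α₁, φ.α₂ ≫ ψ.α₂, φ.α₃ ≫ ψ.α₃,
    by rw [← Category.assoc, φ.comm₁, Category.assoc, ψ.comm₁, Category.assoc],
    by rw [← Category.assoc, φ.comm₂, Category.assoc, ψ.comm₂, Category.assoc]⟩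
  id_comp φ := Hom.ext (Category.id_comp _) (Category.id_comp _) (Category.id_comp _)
  comp_id φ := Hom.ext (Category.comp_id _) (Category.comp_id _) (Category.comp_id _)
  assoc _ _ _ := Hom.ext (Category.assoc _ _ _) (Category.assoc _ _ _) (Category.assoc _ _ _)

@[ext]
lemma hom_ext {X Y : Chain3 C} {φ ψ : X ⟶ Y} (h₁ : φ.α₁ = ψ.α₁) (h₂ : φ.α₂ = ψ.α₂)
    (h₃ : φ.α₃ = ψ.α₃) : φ = ψ := Hom.ext h₁ h₂ h₃

@[simp] lemma id_α₁ (X : Chain3 C) : Hom.α₁ (𝟙 X) = 𝟙 X.X₁ := rfl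
@[simp] lemma id_α₂ (X : Chain3 C) : Hom.α₂ (𝟙 X) = 𝟙 X.X₂ := rfl
@[simp] lemma id_α₃ (X : Chain3 C) : Hom.α₃ (𝟙 X) = 𝟙 X.X₃ := rfl

section

variable {X Y Z : Chain3 C} (φ : X ⟶ Y) (ψ : Y ⟶ Z)

@[simp] lemma comp_α₁ : Hom.α₁ (φ ≫ ψ) = φ.α₁ ≫ ψ.α₁ := rfl
@[simp] lemma comp_α₂ : Hom.α₂ (φ ≫ ψ) = φ.α₂ ≫ ψ.α₂ := rfl
@[simp] lemma comp_α₃ : Hom.α₃ (φ ≫ ψ) = φ.α₃ ≫ ψ.α₃ := rfl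

end

variable [Preadditive C]

section

variable {X Y : Chain3 C}

instance : Zero (X ⟶ Y) := ⟨⟨0, 0, 0, by simp, by simp⟩⟩
instance : Add (X ⟶ Y) := ⟨fun φ ψ => ⟨φ.α₁ + ψ.α₁, φ.α₂ + ψ.α₂, φ.α₃ + ψ.α₃,
  by simp [φ.comm₁, ψ.comm₁], by simp [φ.comm₂, ψ.comm₂]⟩⟩
instance : Neg (X ⟶ Y) := ⟨fun φ => ⟨-φ.α₁, -φ.α₂, -φ.α₃, by simp [φ.comm₁], by simp [φ.comm₂]⟩⟩

@[simp] lemma zero_α₁ : Hom.α₁ (0 : X ⟶ Y) = 0 := rfl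
@[simp] lemma zero_α₂ : Hom.α₂ (0 : X ⟶ Y) = 0 := rfl
@[simp] lemma zero_α₃ : Hom.α₃ (0 : X ⟶ Y) = 0 := rfl
@[simp] lemma add_α₁ (φ ψ : X ⟶ Y) : Hom.α₁ (φ + ψ) = φ.α₁ + ψ.α₁ := rfl
@[simp] lemma add_α₂ (φ ψ : X ⟶ Y) : Hom.α₂ (φ + ψ) = φ.α₂ + ψ.α₂ := rfl
@[simp] lemma add_α₃ (φ ψ : X ⟶ Y) : Hom.α₃ (φ + ψ) = φ.α₃ + ψ.α₃ := rfl
@[simp] lemma neg_α₁ (φ : X ⟶ Y) : Hom.α₁ (-φ) = -φ.α₁ := rfl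
@[simp] lemma neg_α₂ (φ : X ⟶ Y) : Hom.α₂ (-φ) = -φ.α₂ := rfl
@[simp] lemma neg_α₃ (φ : X ⟶ Y) : Hom.α₃ (-φ) = -φ.α₃ := rfl

instance : AddCommGroup (X ⟶ Y) where
  add_assoc _ _ _ := hom_ext (add_assoc _ _ _) (add_assoc _ _ _) (add_assoc _ _ _)
  zero_add _ := hom_ext (zero_add _) (zero_add _) (zero_add _)
  add_zero _ := hom_ext (add_zero _) (add_zero _) (add_zero _)
  add_comm _ _ := hom_ext (add_comm _ _) (add_comm _ _) (add_comm _ _)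
  neg_add_cancel _ := hom_ext (neg_add_cancel _) (neg_add_cancel _) (neg_add_cancel _)
  nsmul := nsmulRec
  zsmul := zsmulRec

end

/-- Morphisms of chains are added componentwise. -/
instance : Preadditive (Chain3 C) where
  add_comp _ _ _ _ _ _ := by ext <;> simp
  comp_add _ _ _ _ _ _ := by ext <;> simp

/-- `(α₁, α₂, α₃)` is null-homotopic if `α₂ = g₁ s + t f₂` for some `s : X₂ ⟶ Y₁` and
`t : X₃ ⟶ Y₂`. -/
def NullHomotopic {X Y : Chain3 C} (φ : X ⟶ Y) : Prop :=
  ∃ (s : X.X₂ ⟶ Y.X₁) (t : X.X₃ ⟶ Y.X₂), φ.α₂ = s ≫ Y.f₁ + X.f₂ ≫ t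

variable (C) in
/-- Two morphisms of chains are homotopic if their difference is null-homotopic. -/
def homotopic : HomRel (Chain3 C) := fun _ _ φ ψ => NullHomotopic (φ - ψ)

lemma homotopic_iff {X Y : Chain3 C} (φ ψ : X ⟶ Y) : homotopic C φ ψ ↔
    ∃ (s : X.X₂ ⟶ Y.X₁) (t : X.X₃ ⟶ Y.X₂), φ.α₂ = s ≫ Y.f₁ + X.f₂ ≫ t + ψ.α₂ := by
  simp only [homotopic, NullHomotopic, sub_eq_add_neg, add_α₂, neg_α₂]
  simp only [← sub_eq_add_neg, sub_eq_iff_eq_add]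

instance : Congruence (homotopic C) where
  equivalence :=
    { refl := fun φ => (homotopic_iff _ _).2 ⟨0, 0, by simp⟩
      symm := fun {φ ψ} h => by
        obtain ⟨s, t, h⟩ := (homotopic_iff _ _).1 h
        exact (homotopic_iff _ _).2 ⟨-s, -t, by rw [h]; simp; abel⟩
      trans := fun {φ ψ χ} h h' => by
        obtain ⟨s, t, h⟩ := (homotopic_iff _ _).1 h
        obtain ⟨s', t', h'⟩ := (homotopic_iff _ _).1 h'
        exact (homotopic_iff _ _).2 ⟨s + s', t + t', by rw [h, h']; simp; abel⟩ }
  comp_left {X Y Z} φ {ψ ψ'} h := by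
    obtain ⟨s, t, h⟩ := (homotopic_iff _ _).1 h
    refine (homotopic_iff _ _).2 ⟨φ.α₂ ≫ s, φ.α₃ ≫ t, ?_⟩
    simp only [comp_α₂, h, Preadditive.comp_add, Category.assoc]
    rw [← Category.assoc X.f₂, φ.comm₂, Category.assoc]
  comp_right {X Y Z} {φ φ'} ψ h := by
    obtain ⟨s, t, h⟩ := (homotopic_iff _ _).1 h
    refine (homotopic_iff _ _).2 ⟨s ≫ ψ.α₁, t ≫ ψ.α₂, ?_⟩
    simp only [comp_α₂, h, Preadditive.add_comp, Category.assoc]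
    rw [ψ.comm₁]

lemma homotopic_add ⦃X Y : Chain3 C⦄ (φ₁ φ₂ ψ₁ ψ₂ : X ⟶ Y) (h : homotopic C φ₁ φ₂)
    (h' : homotopic C ψ₁ ψ₂) : homotopic C (φ₁ + ψ₁) (φ₂ + ψ₂) := by
  obtain ⟨s, t, h⟩ := (homotopic_iff _ _).1 h
  obtain ⟨s', t', h'⟩ := (homotopic_iff _ _).1 h'
  exact (homotopic_iff _ _).2 ⟨s + s', t + t', by simp [h, h']; abel⟩

end Chain3

/-- Adelman's category over `C`: three-term chains over `C`, with morphisms of chains modulo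
null-homotopic ones. -/
abbrev Adelman (C : Type u) [Category.{v} C] [Preadditive C] := Quotient (Chain3.homotopic C)

instance (C : Type u) [Category.{v} C] [Preadditive C] : Preadditive (Adelman C) :=
  Quotient.preadditive _ Chain3.homotopic_add

section Ring

variable (A : Type u) [Ring A]

/-! ### The category of matrices -/

/-- The additive category with objects `A^n`, `n = 0, 1, 2, …`; a morphism `A^n ⟶ A^m` is an
`m × n` matrix, acting from the left on column vectors. -/
structure MatObj (A : Type u) where
  n : ℕ

instance : Category (MatObj A) where
  Hom X Y := Matrix (Fin Y.n) (Fin X.n) A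
  id _ := 1
  comp U V := V * U
  id_comp U := Matrix.mul_one U
  comp_id U := Matrix.one_mul U
  assoc U V W := (Matrix.mul_assoc W V U).symm

instance : Preadditive (MatObj A) where
  homGroup X Y := inferInstanceAs (AddCommGroup (Matrix (Fin Y.n) (Fin X.n) A))
  add_comp _ _ _ U U' V := Matrix.mul_add V U U'
  comp_add _ _ _ U V V' := Matrix.add_mul V V' U

variable {A} in
/-- The chain `A^m ⟶ A^n ⟶ A^p` given by matrices `u` and `v`, as an object of Adelman's
category. -/
def matChain {m n p : ℕ} (u : Matrix (Fin n) (Fin m) A) (v : Matrix (Fin p) (Fin n) A) :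
    Adelman (MatObj A) where
  as := { X₁ := ⟨m⟩, X₂ := ⟨n⟩, X₃ := ⟨p⟩, f₁ := u, f₂ := v }

/-- The functor `A^n ↦ (0 ⟶ A^n ⟶ 0)` to chains; the object `0` is `A^0`. -/
def MatObj.toChain : MatObj A ⥤ Chain3 (MatObj A) where
  obj X := { X₁ := ⟨0⟩, X₂ := X, X₃ := ⟨0⟩, f₁ := 0, f₂ := 0 }
  map U := ⟨0, U, 0, by simp, by simp⟩
  map_id _ := Chain3.hom_ext (Matrix.ext fun i _ => i.elim0) rfl (Matrix.ext fun i _ => i.elim0)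
  map_comp _ _ :=
    Chain3.hom_ext (Matrix.ext fun i _ => i.elim0) rfl (Matrix.ext fun i _ => i.elim0)

/-- The functor `A^n ↦ (0 ⟶ A^n ⟶ 0)` to Adelman's category. -/
def MatObj.toAdelman : MatObj A ⥤ Adelman (MatObj A) :=
  MatObj.toChain A ⋙ Quotient.functor _

/-! ### Finitely presented right modules -/

/-- Finitely presented right `A`-modules, i.e. finitely presented modules over `Aᵐᵒᵖ`. -/
def isFPModule : ObjectProperty (ModuleCat.{u} Aᵐᵒᵖ) := fun M => Module.FinitePresentation Aᵐᵒᵖ M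

/-- The category `mod-A` of finitely presented right `A`-modules. -/
abbrev FPMod := (isFPModule A).FullSubcategory

variable {A} in
/-- Left multiplication of column vectors by a matrix, as a map of right modules. -/
def matLin {m n : ℕ} (U : Matrix (Fin n) (Fin m) A) : (Fin m → A) →ₗ[Aᵐᵒᵖ] (Fin n → A) where
  toFun x := U.mulVec x
  map_add' x y := Matrix.mulVec_add U x y
  map_smul' r x := Matrix.mulVec_smul U r x

instance finitePresentation_free (n : ℕ) : Module.FinitePresentation Aᵐᵒᵖ (Fin n → A) :=
  haveI : Module.FinitePresentation Aᵐᵒᵖ A :=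
    Module.FinitePresentation.of_equiv (M := Aᵐᵒᵖ)
      { toFun := MulOpposite.unop
        invFun := MulOpposite.op
        map_add' := fun _ _ => rfl
        map_smul' := fun _ _ => rfl
        left_inv := fun _ => rfl
        right_inv := fun _ => rfl }
  inferInstance

/-- The functor from the matrix category to `mod-A`, sending the object `n` to the module of
column vectors `A^n`. -/
def MatObj.toMod : MatObj A ⥤ FPMod A where
  obj X := ⟨ModuleCat.of Aᵐᵒᵖ (Fin X.n → A), finitePresentation_free A X.n⟩
  map U := ObjectProperty.homMk (ModuleCat.ofHom (matLin U))
  map_id X := by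
    ext : 2
    exact LinearMap.ext fun x => Matrix.one_mulVec x
  map_comp U V := by
    ext : 2
    exact LinearMap.ext fun x => (Matrix.mulVec_mulVec x V U).symm

instance : (MatObj.toMod A).Faithful where
  map_injective {X Y U V} h := by
    refine Matrix.mulVec_injective ?_
    funext x
    exact congrArg (fun g => g.hom.hom x) h

instance : (MatObj.toMod A).Full where
  map_surjective {X Y} g := by
    let g' : (Fin X.n → A) →ₗ[Aᵐᵒᵖ] (Fin Y.n → A) := g.hom.hom
    refine ⟨Matrix.of fun i j => g' (Pi.single j 1) i, ?_⟩
    ext : 2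
    refine LinearMap.pi_ext (f := matLin (Matrix.of fun i j => g' (Pi.single j 1) i)) (g := g')
      fun j x => ?_
    have h : (Pi.single j x : Fin X.n → A) = MulOpposite.op x • Pi.single j (1 : A) := by
      rw [← Pi.single_smul]
      simp
    rw [h, map_smul, map_smul]
    congr 1
    ext i
    simp [matLin]

/-! ### Finitely presented functors -/

variable {A}

/-- `G ⟶ H ⟶ F ⟶ 0` is exact when evaluated at any finitely presented module. -/
def RightExact {G H F : FPMod A ⥤ AddCommGrpCat.{u}} (φ : G ⟶ H) (π : H ⟶ F) : Prop :=
  ∀ M : FPMod A, Function.Exact (φ.app M) (π.app M) ∧ Function.Surjective (π.app M)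

/-- The representable functor `Hom(X, -)` on `mod-A`. -/
abbrev homFrom (X : FPMod A) : FPMod A ⥤ AddCommGrpCat.{u} := preadditiveCoyoneda.obj (op X)

/-- The natural transformation `Hom(f, -) : Hom(Y, -) ⟶ Hom(X, -)`. -/
abbrev homFromMap {X Y : FPMod A} (f : X ⟶ Y) : homFrom Y ⟶ homFrom X :=
  preadditiveCoyoneda.map f.op

variable (A) in
/-- A functor `F` on `mod-A` is finitely presented if there is an exact sequence
`Hom(Y, -) ⟶ Hom(X, -) ⟶ F ⟶ 0` with `X`, `Y` in `mod-A`. -/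
def isFPFunctor : ObjectProperty (FPMod A ⥤ AddCommGrpCat.{u}) := fun F =>
  ∃ (X Y : FPMod A) (φ : homFrom Y ⟶ homFrom X) (π : homFrom X ⟶ F), RightExact φ π

variable (A) in
/-- The category `mod-(mod-A)` of finitely presented functors from `mod-A` to abelian groups. -/
abbrev FPFun := (isFPFunctor A).FullSubcategory

lemma isFPFunctor_homFrom (X : FPMod A) : isFPFunctor A (homFrom X) :=
  ⟨X, X, 0, 𝟙 _, fun _ => ⟨fun y => ⟨fun h => ⟨0, h.symm⟩, by rintro ⟨_, rfl⟩; rfl⟩,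
    fun y => ⟨y, rfl⟩⟩⟩

variable (A) in
/-- The functor `X ↦ Hom(X, -)` from `mod-A` to the opposite of `mod-(mod-A)`. -/
def FPMod.toFPFun : FPMod A ⥤ (FPFun A)ᵒᵖ where
  obj X := op ⟨homFrom X, isFPFunctor_homFrom X⟩
  map f := (ObjectProperty.homMk (homFromMap f)).op
  map_id X := by
    apply Quiver.Hom.unop_inj
    ext : 1
    exact preadditiveCoyoneda.map_id (op X)
  map_comp f g := by
    apply Quiver.Hom.unop_inj
    ext : 1
    exact preadditiveCoyoneda.map_comp g.op f.op

/-- A projective presentation `Hom(Y, -) ⟶ Hom(X, -) ⟶ F ⟶ 0` whose first map is `Hom(f, -)`. -/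
structure ProjPresentation {X Y : FPMod A} (f : X ⟶ Y) (F : FPFun A) where
  π : homFrom X ⟶ F.obj
  exact : RightExact (homFromMap f) π

/-- A commutative diagram with exact rows
```
A^m --a--> A^n --p--> X --> 0
 |b         |c        |f
A^k --d--> A^l --q--> Y --> 0
```
-/
structure FreeDiagram {m n k l : ℕ} (a : Matrix (Fin n) (Fin m) A) (b : Matrix (Fin k) (Fin m) A)
    (c : Matrix (Fin l) (Fin n) A) (d : Matrix (Fin l) (Fin k) A) {X Y : FPMod A} (f : X ⟶ Y) where
  p : (MatObj.toMod A).obj ⟨n⟩ ⟶ X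
  q : (MatObj.toMod A).obj ⟨l⟩ ⟶ Y
  exact_p : Function.Exact (matLin a) p.hom.hom
  surjective_p : Function.Surjective p.hom.hom
  exact_q : Function.Exact (matLin d) q.hom.hom
  surjective_q : Function.Surjective q.hom.hom
  comm_left : c * a = d * b
  comm_right : p ≫ f = (MatObj.toMod A).map c ≫ q

/-- The chain `A^m ⊕ A^k ⟶ A^n ⊕ A^k ⟶ A^l` with maps `[[a, 0], [b, -1]]` and `[c, -d]`. -/
def blockChain {m n k l : ℕ} (a : Matrix (Fin n) (Fin m) A) (b : Matrix (Fin k) (Fin m) A)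
    (c : Matrix (Fin l) (Fin n) A) (d : Matrix (Fin l) (Fin k) A) : Adelman (MatObj A) :=
  matChain
    ((Matrix.fromBlocks a 0 b (-1 : Matrix (Fin k) (Fin k) A)).reindex finSumFinEquiv finSumFinEquiv)
    ((Matrix.fromCols c (-d)).reindex (Equiv.refl (Fin l)) finSumFinEquiv)

/-! ### The embeddings of the ring -/

variable (A)

/-- The embedding of `A`, as a category with one object, into the matrix category. -/
def ringToMat : SingleObj A ⥤ MatObj A where
  obj _ := ⟨1⟩
  map r := (Matrix.of fun _ _ => r : Matrix (Fin 1) (Fin 1) A)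
  map_id _ := Matrix.ext fun i j => by
    rw [Subsingleton.elim i j]
    exact (Matrix.one_apply_eq j).symm
  map_comp r s := Matrix.ext fun i j =>
    (by simp [Matrix.mul_apply] : s * r = ((Matrix.of fun _ _ => s : Matrix (Fin 1) (Fin 1) A) *
      (Matrix.of fun _ _ => r : Matrix (Fin 1) (Fin 1) A)) i j)

/-- The canonical functor `A ⟶ (mod-(mod-A))ᵒᵖ`, `A ↦ Hom(A, -)`. -/
abbrev ringToFPFun : SingleObj A ⥤ (FPFun A)ᵒᵖ :=
  ringToMat A ⋙ MatObj.toMod A ⋙ FPMod.toFPFun A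

/-- The canonical functor from `A` to Adelman's category, `A ↦ (0 ⟶ A ⟶ 0)`. -/
abbrev ringToAdelman : SingleObj A ⥤ Adelman (MatObj A) :=
  ringToMat A ⋙ MatObj.toAdelman A

end Ring

end

/-!
Let `P` denote the inclusion of the matrix category into `mod-A`. A chain `X₁ ⟶ X₂ ⟶ X₃` has a
cohomology functor: its value at `M` is the group of maps `P X₂ ⟶ M` vanishing on `P X₁`, modulo
the maps factoring through `P X₃`. If `X` and `Y` are the cokernels of `P X₁ ⟶ P X₂` and
`P X₁ ⟶ P X₃`, then this functor is the cokernel of `Hom(f, -)` for the induced map `f : X ⟶ Y`, so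
it is finitely presented. By the Yoneda lemma its natural transformations are determined by the
class of the projection `P X₂ ⟶ X`, and projectivity of free modules lifts them to morphisms of
chains, uniquely up to homotopy. Conversely, every `f : X ⟶ Y` arises from a chain: adding the
generators `A^k` and the relations `[b, -1]` to a free presentation of `X` does not change `X`, but
allows a second map `[c, -d]` for which the composite of the chain is `[0, d]`, with cokernel `Y`.
-/

noncomputable section

section Presentation

variable {C : Type*} [Category C] {D : Type*} [Category D] [Preadditive D]

/-- `P m ⟶ P n ⟶ X ⟶ 0` is a presentation of `X` by objects in the image of `P`: the map `p` is
a cokernel of `P a`, and the objects `P k` are projective relative to the sequence. The lifts are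
morphisms of `C`, so that `P` need be neither full nor faithful. -/
structure IsPresentation (P : C ⥤ D) {m n : C} (a : m ⟶ n) {X : D} (p : P.obj n ⟶ X) : Prop where
  comp_eq_zero : P.map a ≫ p = 0
  epi : Epi p
  exists_desc {M : D} (g : P.obj n ⟶ M) (hg : P.map a ≫ g = 0) : ∃ g' : X ⟶ M, p ≫ g' = g
  exists_lift {k : C} (g : P.obj k ⟶ X) : ∃ U : k ⟶ n, P.map U ≫ p = g
  exists_lift_of_comp_eq_zero {k : C} (V : k ⟶ n) (hV : P.map V ≫ p = 0) : ∃ U : k ⟶ m, U ≫ a = V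

lemma IsPresentation.of_isSplitEpi_comp {P : C ⥤ D} {k m n : C} {a : m ⟶ n} {X : D}
    {p : P.obj n ⟶ X} (h : IsPresentation P a p) (r : k ⟶ m) [IsSplitEpi r] :
    IsPresentation P (r ≫ a) p where
  comp_eq_zero := by rw [P.map_comp, Category.assoc, h.comp_eq_zero, Limits.comp_zero]
  epi := h.epi
  exists_desc g hg := h.exists_desc g (by
    rwa [P.map_comp, Category.assoc, ← Limits.comp_zero (f := P.map r), cancel_epi] at hg)
  exists_lift := h.exists_lift
  exists_lift_of_comp_eq_zero V hV := by
    obtain ⟨U, hU⟩ := h.exists_lift_of_comp_eq_zero V hV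
    exact ⟨U ≫ section_ r, by simpa using hU⟩

/-- Every morphism of `C` is the relation morphism of a presentation in the sense of
`IsPresentation`. -/
class HasPresentations (P : C ⥤ D) : Prop where
  exists_isPresentation (P) {m n : C} (a : m ⟶ n) :
    ∃ (X : D) (p : P.obj n ⟶ X), IsPresentation P a p

/-- `f` is the map `coker P f₁ ⟶ coker P (f₁ ≫ f₂)` induced by the second map of the chain
`Z = (f₁, f₂)`, both cokernels being presentations. -/
structure Chain3.IsCokernelMap (P : C ⥤ D) (Z : Chain3 C) {X Y : D} (p : P.obj Z.X₂ ⟶ X)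
    (q : P.obj Z.X₃ ⟶ Y) (f : X ⟶ Y) : Prop where
  source : IsPresentation P Z.f₁ p
  target : IsPresentation P (Z.f₁ ≫ Z.f₂) q
  comm : p ≫ f = P.map Z.f₂ ≫ q

lemma Chain3.exists_isCokernelMap (P : C ⥤ D) [HasPresentations P] (Z : Chain3 C) :
    ∃ (X Y : D) (p : P.obj Z.X₂ ⟶ X) (q : P.obj Z.X₃ ⟶ Y) (f : X ⟶ Y),
      Z.IsCokernelMap P p q f := by
  obtain ⟨X, p, hp⟩ := HasPresentations.exists_isPresentation P Z.f₁
  obtain ⟨Y, q, hq⟩ := HasPresentations.exists_isPresentation P (Z.f₁ ≫ Z.f₂)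
  obtain ⟨f, hf⟩ := hp.exists_desc (P.map Z.f₂ ≫ q) (by
    rw [← Category.assoc, ← P.map_comp, hq.comp_eq_zero])
  exact ⟨X, Y, p, q, f, hp, hq, hf⟩

end Presentation

section Block

open Limits

variable {C : Type*} [Category C] [Preadditive C] {m n k l : C} (S : BinaryBicone m k)
  (T : BinaryBicone n k)

/-- The morphism `[[a, 0], [b, -1]] : m ⊕ k ⟶ n ⊕ k`, for given bicones on the two sums. -/
def blockHom (a : m ⟶ n) (b : m ⟶ k) : S.pt ⟶ T.pt :=
  S.fst ≫ a ≫ T.inl + S.fst ≫ b ≫ T.inr - S.snd ≫ T.inr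

/-- The morphism `[c, -d] : n ⊕ k ⟶ l`, for a given bicone on the sum. -/
def rowHom (c : n ⟶ l) (d : k ⟶ l) : T.pt ⟶ l :=
  T.fst ≫ c - T.snd ≫ d

variable {S T} (a : m ⟶ n) (b : m ⟶ k) (c : n ⟶ l) (d : k ⟶ l)

lemma inl_blockHom : S.inl ≫ blockHom S T a b = a ≫ T.inl + b ≫ T.inr := by
  simp [blockHom]

lemma inr_blockHom : S.inr ≫ blockHom S T a b = -T.inr := by
  simp [blockHom]

lemma blockHom_fst : blockHom S T a b ≫ T.fst = S.fst ≫ a := by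
  simp [blockHom]

variable {a b c d} in
lemma blockHom_rowHom (h : a ≫ c = b ≫ d) : blockHom S T a b ≫ rowHom T c d = S.snd ≫ d := by
  simp [blockHom, rowHom, h]

variable {D : Type*} [Category D] [Preadditive D] {P : C ⥤ D}

variable [P.Additive] {a}

/-- The extra generators `k` are killed by the extra relations `[0, -1]`. -/
lemma IsPresentation.block (hT : T.IsBilimit) {X : D} {p : P.obj n ⟶ X}
    (h : IsPresentation P a p) : IsPresentation P (blockHom S T a b) (P.map T.fst ≫ p) where
  comp_eq_zero := by
    rw [← P.map_comp_assoc, blockHom_fst, P.map_comp_assoc, h.comp_eq_zero, comp_zero]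
  epi :=
    have := h.epi
    epi_comp _ _
  exists_desc g hg := by
    have hinr : P.map T.inr ≫ g = 0 := by
      have := P.map S.inr ≫= hg
      rwa [← P.map_comp_assoc, inr_blockHom, P.map_neg, Preadditive.neg_comp, comp_zero,
        neg_eq_zero] at this
    have hinl : P.map a ≫ P.map T.inl ≫ g = 0 := by
      have := P.map S.inl ≫= hg
      rwa [← P.map_comp_assoc, inl_blockHom, P.map_add, Preadditive.add_comp, P.map_comp_assoc,
        P.map_comp_assoc, hinr, comp_zero, comp_zero, add_zero] at this
    obtain ⟨g', hg'⟩ := h.exists_desc _ hinl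
    refine ⟨g', ?_⟩
    calc (P.map T.fst ≫ p) ≫ g' = P.map (T.fst ≫ T.inl + T.snd ≫ T.inr) ≫ g := by
          simp [hg', hinr]
      _ = g := by rw [IsBilimit.binary_total hT, P.map_id, Category.id_comp]
  exists_lift g := by
    obtain ⟨U, hU⟩ := h.exists_lift g
    exact ⟨U ≫ T.inl, by simp [hU, ← P.map_comp_assoc]⟩
  exists_lift_of_comp_eq_zero V hV := by
    obtain ⟨U, hU⟩ := h.exists_lift_of_comp_eq_zero (V ≫ T.fst) (by simpa using hV)
    refine ⟨U ≫ S.inl + (U ≫ b - V ≫ T.snd) ≫ S.inr, ?_⟩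
    calc (U ≫ S.inl + (U ≫ b - V ≫ T.snd) ≫ S.inr) ≫ blockHom S T a b
        = (U ≫ a) ≫ T.inl + V ≫ T.snd ≫ T.inr := by
          simp [inl_blockHom, inr_blockHom]
      _ = V ≫ (T.fst ≫ T.inl + T.snd ≫ T.inr) := by simp [hU]
      _ = V := by rw [IsBilimit.binary_total hT, Category.comp_id]

variable {b c d} in
lemma Chain3.IsCokernelMap.block (hT : T.IsBilimit) {X Y : D} {p : P.obj n ⟶ X}
    {q : P.obj l ⟶ Y} {f : X ⟶ Y} (hp : IsPresentation P a p) (hq : IsPresentation P d q)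
    (h : a ≫ c = b ≫ d) (hf : p ≫ f = P.map c ≫ q) :
    Chain3.IsCokernelMap P ⟨S.pt, T.pt, l, blockHom S T a b, rowHom T c d⟩
      (P.map T.fst ≫ p) q f where
  source := hp.block b hT
  target := by
    rw [blockHom_rowHom h]
    exact hq.of_isSplitEpi_comp S.snd
  comm := by
    simp [rowHom, hf, hq.comp_eq_zero]

end Block

namespace Chain3

section Cohomology

universe w v₁ u₁ u₂

variable {C : Type u₁} [Category.{v₁} C] {D : Type u₂} [Category.{w} D] [Preadditive D] (P : C ⥤ D)

/-- The maps `P X₂ ⟶ M` vanishing on `P X₁`. -/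
def cocycles (X : Chain3 C) (M : D) : AddSubgroup (P.obj X.X₂ ⟶ M) :=
  (Preadditive.leftComp M (P.map X.f₁)).ker

/-- The maps `P X₂ ⟶ M` factoring through `P X₃`. -/
def coboundaries (X : Chain3 C) (M : D) : AddSubgroup (P.obj X.X₂ ⟶ M) :=
  (Preadditive.leftComp M (P.map X.f₂)).range

/-- The cohomology of the chain `X` with coefficients in `M`: the maps `P X₂ ⟶ M` vanishing on
`P X₁`, modulo those among them which factor through `P X₃`. -/
abbrev Cohomology (X : Chain3 C) (M : D) : Type w :=
  cocycles P X M ⧸ (coboundaries P X M).addSubgroupOf (cocycles P X M)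

namespace Cohomology

variable {P} {X Y Z : Chain3 C} {K M N L : D}

/-- The cohomology class of a map `P X₂ ⟶ M` which vanishes on `P X₁`. -/
def mk (x : P.obj X.X₂ ⟶ M) (hx : P.map X.f₁ ≫ x = 0) : Cohomology P X M :=
  QuotientAddGroup.mk ⟨x, hx⟩

lemma exists_mk_eq (c : Cohomology P X M) : ∃ x hx, mk x hx = c := by
  obtain ⟨⟨x, hx⟩, rfl⟩ := QuotientAddGroup.mk_surjective c
  exact ⟨x, hx, rfl⟩

lemma hom_ext {G : Type*} [AddGroup G] {f g : Cohomology P X M →+ G}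
    (h : ∀ x hx, f (mk x hx) = g (mk x hx)) : f = g :=
  AddMonoidHom.ext fun c => by
    obtain ⟨x, hx, rfl⟩ := exists_mk_eq c
    exact h x hx

lemma mk_congr {x y : P.obj X.X₂ ⟶ M} (h : x = y) (hx : P.map X.f₁ ≫ x = 0) :
    mk x hx = mk y (h ▸ hx) := by
  subst h; rfl

lemma mk_add (x y : P.obj X.X₂ ⟶ M) (hx : P.map X.f₁ ≫ x = 0) (hy : P.map X.f₁ ≫ y = 0) :
    mk x hx + mk y hy = mk (x + y) (by rw [Preadditive.comp_add, hx, hy, add_zero]) := rfl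

lemma mk_eq_zero_iff (x : P.obj X.X₂ ⟶ M) (hx : P.map X.f₁ ≫ x = 0) :
    mk x hx = 0 ↔ ∃ z : P.obj X.X₃ ⟶ M, P.map X.f₂ ≫ z = x :=
  (QuotientAddGroup.eq_zero_iff _).trans Iff.rfl

lemma mk_eq_mk_iff (x y : P.obj X.X₂ ⟶ M) (hx : P.map X.f₁ ≫ x = 0) (hy : P.map X.f₁ ≫ y = 0) :
    mk x hx = mk y hy ↔ ∃ z : P.obj X.X₃ ⟶ M, P.map X.f₂ ≫ z = x - y := by
  rw [← sub_eq_zero, ← mk_eq_zero_iff (x - y) (by rw [Preadditive.comp_sub, hx, hy, sub_zero])]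
  rfl

lemma map_f₁_comp_cocycle (φ : X ⟶ Y) (g : M ⟶ N) {x : P.obj Y.X₂ ⟶ M}
    (hx : P.map Y.f₁ ≫ x = 0) : P.map X.f₁ ≫ P.map φ.α₂ ≫ x ≫ g = 0 := by
  rw [← P.map_comp_assoc, φ.comm₁, P.map_comp_assoc, reassoc_of% hx, Limits.zero_comp,
    Limits.comp_zero]

/-- The map induced on cohomology by a map of chains and a map of coefficients. -/
def map (φ : X ⟶ Y) (g : M ⟶ N) : Cohomology P Y M →+ Cohomology P X N :=
  QuotientAddGroup.map _ _
    ((((Preadditive.leftComp N (P.map φ.α₂)).comp (Preadditive.rightComp _ g)).comp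
      (cocycles P Y M).subtype).codRestrict (cocycles P X N)
        fun x => map_f₁_comp_cocycle φ g x.2) (by
      rintro ⟨_, hx⟩ ⟨z, rfl⟩
      refine ⟨P.map φ.α₃ ≫ z ≫ g, ?_⟩
      change P.map X.f₂ ≫ P.map φ.α₃ ≫ z ≫ g = P.map φ.α₂ ≫ (P.map Y.f₂ ≫ z) ≫ g
      rw [← P.map_comp_assoc, φ.comm₂, P.map_comp_assoc, Category.assoc])

lemma map_mk (φ : X ⟶ Y) (g : M ⟶ N) (x : P.obj Y.X₂ ⟶ M) (hx : P.map Y.f₁ ≫ x = 0) :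
    map φ g (mk x hx) = mk (P.map φ.α₂ ≫ x ≫ g) (map_f₁_comp_cocycle φ g hx) := rfl

lemma map_id : map (P := P) (𝟙 X) (𝟙 M) = AddMonoidHom.id _ := by
  refine hom_ext fun x hx => ?_
  rw [map_mk]
  exact mk_congr (by simp) _

lemma map_comp (φ : X ⟶ Y) (ψ : Y ⟶ Z) (g : M ⟶ N) (h : N ⟶ L) :
    map (P := P) (φ ≫ ψ) (g ≫ h) = (map φ h).comp (map ψ g) := by
  refine hom_ext fun x hx => ?_
  simp only [AddMonoidHom.comp_apply, map_mk]
  exact mk_congr (by simp) _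

lemma map_add [Preadditive C] [P.Additive] (φ ψ : X ⟶ Y) (g : M ⟶ N) :
    map (P := P) (φ + ψ) g = map φ g + map ψ g := by
  refine hom_ext fun x hx => ?_
  simp only [AddMonoidHom.add_apply, map_mk, mk_add]
  exact mk_congr (by simp) _

lemma map_eq_of_homotopic [Preadditive C] [P.Additive] {φ ψ : X ⟶ Y} (h : homotopic C φ ψ)
    (g : M ⟶ N) : map (P := P) φ g = map ψ g := by
  refine hom_ext fun x hx => ?_
  obtain ⟨s, t, hst⟩ := (homotopic_iff _ _).1 h
  simp only [map_mk, mk_eq_mk_iff]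
  refine ⟨P.map t ≫ x ≫ g, ?_⟩
  rw [hst]
  simp [reassoc_of% hx]

lemma exists_map_mk_eq {p : P.obj X.X₂ ⟶ K} (hp : IsPresentation P X.f₁ p)
    (c : Cohomology P X M) : ∃ g : K ⟶ M, map (𝟙 X) g (mk p hp.comp_eq_zero) = c := by
  obtain ⟨x, hx, rfl⟩ := exists_mk_eq c
  obtain ⟨g, rfl⟩ := hp.exists_desc x hx
  exact ⟨g, by rw [map_mk]; exact mk_congr (by simp) _⟩

lemma homotopic_of_map_mk_eq [Preadditive C] [P.Additive] {φ ψ : X ⟶ Y} {p : P.obj Y.X₂ ⟶ K}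
    (hp : IsPresentation P Y.f₁ p)
    (h : map φ (𝟙 K) (mk p hp.comp_eq_zero) = map ψ (𝟙 K) (mk p hp.comp_eq_zero)) :
    homotopic C φ ψ := by
  rw [map_mk, map_mk, mk_eq_mk_iff] at h
  obtain ⟨z, hz⟩ := h
  obtain ⟨t, rfl⟩ := hp.exists_lift z
  obtain ⟨s, hs⟩ := hp.exists_lift_of_comp_eq_zero (φ.α₂ - ψ.α₂ - X.f₂ ≫ t) (by
    simp only [Functor.map_sub, Functor.map_comp, Preadditive.sub_comp, Category.assoc, hz,
      Category.comp_id, sub_self])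
  exact (homotopic_iff _ _).2 ⟨s, t, by rw [hs]; abel⟩

lemma exists_map_mk_eq_of_map_eq_zero [Preadditive C] [P.Additive] {p : P.obj Y.X₂ ⟶ K}
    {q : P.obj Y.X₃ ⟶ L} {f : K ⟶ L} (h : Y.IsCokernelMap P p q f) (c : Cohomology P X K)
    (hc : map (𝟙 X) f c = 0) :
    ∃ φ : X ⟶ Y, map φ (𝟙 K) (mk p h.source.comp_eq_zero) = c := by
  obtain ⟨x, hx, rfl⟩ := exists_mk_eq c
  obtain ⟨α₂, rfl⟩ := h.source.exists_lift x
  obtain ⟨α₁, h₁⟩ := h.source.exists_lift_of_comp_eq_zero (X.f₁ ≫ α₂) (by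
    rw [P.map_comp_assoc, hx])
  rw [map_mk, mk_eq_zero_iff] at hc
  obtain ⟨z, hz⟩ := hc
  obtain ⟨α₃, rfl⟩ := h.target.exists_lift z
  have hw : P.map (X.f₂ ≫ α₃ - α₂ ≫ Y.f₂) ≫ q = 0 := by
    simp only [Functor.map_sub, Functor.map_comp, Preadditive.sub_comp, Category.assoc, hz,
      ← h.comm]
    simp
  -- the right-hand square commutes up to `w ≫ f₁ ≫ f₂`; correct `α₂` by the coboundary `w ≫ f₁`
  obtain ⟨w, hw⟩ := h.target.exists_lift_of_comp_eq_zero _ hw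
  refine ⟨⟨α₁ + X.f₁ ≫ w, α₂ + w ≫ Y.f₁, α₃, by simp [h₁], by simp [hw]⟩, ?_⟩
  rw [map_mk]
  exact mk_congr (by simp [h.source.comp_eq_zero]) _

end Cohomology

/-- Cohomology of chains as a bifunctor. -/
def cohomologyBifunctor : (Chain3 C)ᵒᵖ × D ⥤ AddCommGrpCat.{w} where
  obj X := AddCommGrpCat.of (Cohomology P X.1.unop X.2)
  map φ := AddCommGrpCat.ofHom (Cohomology.map φ.1.unop φ.2)
  map_id _ := AddCommGrpCat.hom_ext Cohomology.map_id
  map_comp φ ψ := AddCommGrpCat.hom_ext (Cohomology.map_comp ψ.1.unop φ.1.unop φ.2 ψ.2)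

/-- The contravariant functor which sends a chain to its cohomology functor
`M ↦ Cohomology P X M`. -/
def cohomology : Chain3 C ⥤ (D ⥤ AddCommGrpCat.{w})ᵒᵖ :=
  (Functor.curry.obj (cohomologyBifunctor P)).rightOp

variable {P} {X Y : Chain3 C}

lemma cohomology_hom_naturality (η : (cohomology P).obj X ⟶ (cohomology P).obj Y) {M N : D}
    (g : M ⟶ N) (c : Cohomology P Y M) :
    η.unop.app N (Cohomology.map (𝟙 Y) g c) = Cohomology.map (𝟙 X) g (η.unop.app M c) :=
  NatTrans.naturality_apply (φ := η.unop) g c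

lemma cohomology_map_app (φ : X ⟶ Y) (M : D) (c : Cohomology P Y M) :
    ((cohomology P).map φ).unop.app M c = Cohomology.map φ (𝟙 M) c := rfl

lemma cohomology_hom_ext {F : D ⥤ AddCommGrpCat.{w}} {K : D} {p : P.obj X.X₂ ⟶ K}
    (hp : IsPresentation P X.f₁ p) {η θ : ((cohomology P).obj X).unop ⟶ F}
    (h : η.app K (Cohomology.mk p hp.comp_eq_zero) = θ.app K (Cohomology.mk p hp.comp_eq_zero)) :
    η = θ := by
  ext M (c : Cohomology P X M)
  obtain ⟨g, rfl⟩ := Cohomology.exists_map_mk_eq hp c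
  exact (NatTrans.naturality_apply (φ := η) g _).trans
    ((congrArg (F.map g) h).trans (NatTrans.naturality_apply (φ := θ) g _).symm)

variable [Preadditive C] [P.Additive]

instance : (cohomology P).Additive where
  map_add := Quiver.Hom.unop_inj <| NatTrans.ext <| funext fun M =>
    AddCommGrpCat.hom_ext (Cohomology.map_add _ _ (𝟙 M))

lemma cohomology_map_eq_of_homotopic {φ ψ : X ⟶ Y} (h : homotopic C φ ψ) :
    (cohomology P).map φ = (cohomology P).map ψ :=
  Quiver.Hom.unop_inj <| NatTrans.ext <| funext fun M =>
    AddCommGrpCat.hom_ext (Cohomology.map_eq_of_homotopic h (𝟙 M))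

variable [HasPresentations P]

lemma homotopic_of_cohomology_map_eq {φ ψ : X ⟶ Y}
    (h : (cohomology P).map φ = (cohomology P).map ψ) : homotopic C φ ψ := by
  obtain ⟨K, p, hp⟩ := HasPresentations.exists_isPresentation P Y.f₁
  refine Cohomology.homotopic_of_map_mk_eq hp ?_
  rw [← cohomology_map_app, h, cohomology_map_app]

instance : (cohomology P).Full where
  map_surjective {X Y} η := by
    obtain ⟨K, L, p, q, f, h⟩ := Y.exists_isCokernelMap P
    have hp : Cohomology.map (𝟙 Y) f (Cohomology.mk p h.source.comp_eq_zero) = 0 := by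
      rw [Cohomology.map_mk, Cohomology.mk_eq_zero_iff]
      exact ⟨q, by simp [h.comm]⟩
    have hf : Cohomology.map (𝟙 X) f
        (η.unop.app K (Cohomology.mk p h.source.comp_eq_zero)) = 0 :=
      (cohomology_hom_naturality η f _).symm.trans
        ((congrArg (η.unop.app L) hp).trans (_root_.map_zero (η.unop.app L).hom))
    obtain ⟨φ, hφ⟩ := Cohomology.exists_map_mk_eq_of_map_eq_zero h _ hf
    exact ⟨φ, Quiver.Hom.unop_inj (cohomology_hom_ext h.source hφ)⟩

end Cohomology

end Chain3

namespace Adelman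

universe w v₁ u₁ u₂

variable {C : Type u₁} [Category.{v₁} C] [Preadditive C] {D : Type u₂} [Category.{w} D]
  [Preadditive D] (P : C ⥤ D) [P.Additive]

/-- The cohomology functor `M ↦ Cohomology P X M` of a chain `X`, as a functor on Adelman's
category. -/
def cohomology : Adelman C ⥤ (D ⥤ AddCommGrpCat.{w})ᵒᵖ :=
  CategoryTheory.Quotient.lift _ (Chain3.cohomology P) fun _ _ _ _ h =>
    Chain3.cohomology_map_eq_of_homotopic h

instance : (CategoryTheory.Quotient.functor (Chain3.homotopic C)).Additive where

instance : (cohomology P).Additive :=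
  have : (CategoryTheory.Quotient.functor _ ⋙ cohomology P).Additive :=
    inferInstanceAs (Chain3.cohomology P).Additive
  Functor.additive_of_full_essSurj_comp (CategoryTheory.Quotient.functor _) (cohomology P)

variable [HasPresentations P]

instance : (cohomology P).Full where
  map_surjective η := by
    obtain ⟨φ, hφ⟩ := (Chain3.cohomology P).map_surjective η
    exact ⟨(CategoryTheory.Quotient.functor _).map φ, hφ⟩

instance : (cohomology P).Faithful where
  map_injective {X Y φ ψ} h := by
    obtain ⟨φ, rfl⟩ := (CategoryTheory.Quotient.functor _).map_surjective φ
    obtain ⟨ψ, rfl⟩ := (CategoryTheory.Quotient.functor _).map_surjective ψ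
    exact CategoryTheory.Quotient.sound _ (Chain3.homotopic_of_cohomology_map_eq (P := P) h)

end Adelman

section Coyoneda

universe w v₁ u₁ u₂

variable {C : Type u₁} [Category.{v₁} C] {D : Type u₂} [Category.{w} D] [Preadditive D]
  {P : C ⥤ D} {Z : Chain3 C} {X Y : D}

/-- The map `Hom(X, -) ⟶ Cohomology P Z`, `g ↦ [p ≫ g]`, for `p : P Z₂ ⟶ X` vanishing on
`P Z₁`. -/
def coyonedaToCohomology (p : P.obj Z.X₂ ⟶ X) (hp : P.map Z.f₁ ≫ p = 0) :
    preadditiveCoyoneda.obj (op X) ⟶ ((Chain3.cohomology P).obj Z).unop where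
  app M := AddCommGrpCat.ofHom <|
    AddMonoidHom.mk' (fun g : X ⟶ M => Chain3.Cohomology.mk (p ≫ g) (by
      rw [reassoc_of% hp, Limits.zero_comp])) fun g h => by
        rw [Chain3.Cohomology.mk_add]
        exact Chain3.Cohomology.mk_congr (Preadditive.comp_add ..) _
  naturality M N k := by
    ext (g : X ⟶ M)
    change Chain3.Cohomology.mk (p ≫ g ≫ k) _ = Chain3.Cohomology.map (𝟙 Z) k (.mk (p ≫ g) _)
    rw [Chain3.Cohomology.map_mk]
    exact Chain3.Cohomology.mk_congr (by simp) _

lemma coyonedaToCohomology_app {p : P.obj Z.X₂ ⟶ X} (hp : P.map Z.f₁ ≫ p = 0) {M : D}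
    (g : X ⟶ M) : (coyonedaToCohomology p hp).app M g =
      Chain3.Cohomology.mk (p ≫ g) (by rw [reassoc_of% hp, Limits.zero_comp]) := rfl

lemma coyonedaToCohomology_surjective {p : P.obj Z.X₂ ⟶ X} (hp : IsPresentation P Z.f₁ p)
    (M : D) : Function.Surjective ((coyonedaToCohomology p hp.comp_eq_zero).app M) := by
  intro c
  obtain ⟨x, hx, rfl⟩ := Chain3.Cohomology.exists_mk_eq c
  obtain ⟨g, rfl⟩ := hp.exists_desc x hx
  exact ⟨g, rfl⟩

lemma Chain3.IsCokernelMap.exact {p : P.obj Z.X₂ ⟶ X} {q : P.obj Z.X₃ ⟶ Y} {f : X ⟶ Y}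
    (h : Z.IsCokernelMap P p q f) (M : D) : Function.Exact ((preadditiveCoyoneda.map f.op).app M)
      ((coyonedaToCohomology p h.source.comp_eq_zero).app M) := by
  intro (g : X ⟶ M)
  rw [coyonedaToCohomology_app]
  refine (Chain3.Cohomology.mk_eq_zero_iff _ _).trans ⟨?_, ?_⟩
  · rintro ⟨z, hz⟩
    obtain ⟨y, rfl⟩ := h.target.exists_desc z (by
      rw [P.map_comp_assoc, hz, reassoc_of% h.source.comp_eq_zero, Limits.zero_comp])
    have := h.source.epi
    refine ⟨y, (cancel_epi p).1 ?_⟩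
    exact ((reassoc_of% h.comm) y).trans hz
  · rintro ⟨y, rfl⟩
    exact ⟨q ≫ (y : Y ⟶ M), ((reassoc_of% h.comm) (y : Y ⟶ M)).symm⟩

/-- For a chain with zero maps there are neither cocycle conditions nor coboundaries. -/
lemma isIso_coyonedaToCohomology_id (h₁ : P.map Z.f₁ = 0) (h₂ : P.map Z.f₂ = 0) :
    IsIso (coyonedaToCohomology (𝟙 (P.obj Z.X₂)) ((Category.comp_id _).trans h₁)) := by
  have (M : D) : IsIso
      ((coyonedaToCohomology (𝟙 (P.obj Z.X₂)) ((Category.comp_id _).trans h₁)).app M) := by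
    refine (ConcreteCategory.isIso_iff_bijective _).2 ⟨?_, fun c => ?_⟩
    · refine (injective_iff_map_eq_zero _).2 fun (g : P.obj Z.X₂ ⟶ M) hg => ?_
      obtain ⟨z, hz⟩ := (Chain3.Cohomology.mk_eq_zero_iff _ _).1 hg
      rw [h₂, Limits.zero_comp, Category.id_comp] at hz
      exact hz.symm
    · obtain ⟨x, hx, rfl⟩ := Chain3.Cohomology.exists_mk_eq c
      exact ⟨x, Chain3.Cohomology.mk_congr (Category.id_comp _) _⟩
  exact NatIso.isIso_of_isIso_app _

lemma coyonedaToCohomology_naturality {Z' : Chain3 C} (φ : Z ⟶ Z') {p : P.obj Z.X₂ ⟶ X}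
    {p' : P.obj Z'.X₂ ⟶ Y} (hp : P.map Z.f₁ ≫ p = 0) (hp' : P.map Z'.f₁ ≫ p' = 0) {f : X ⟶ Y}
    (hf : P.map φ.α₂ ≫ p' = p ≫ f) :
    coyonedaToCohomology p' hp' ≫ ((Chain3.cohomology P).map φ).unop =
      preadditiveCoyoneda.map f.op ≫ coyonedaToCohomology p hp := by
  ext M (g : Y ⟶ M)
  change Chain3.Cohomology.map φ (𝟙 M) (.mk (p' ≫ g) _) = Chain3.Cohomology.mk (p ≫ f ≫ g) _
  rw [Chain3.Cohomology.map_mk]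
  exact Chain3.Cohomology.mk_congr (by simp [reassoc_of% hf]) _

end Coyoneda

section FreePresentation

variable {A : Type u} [Ring A]

instance : (MatObj.toMod A).Additive where
  map_add {X Y U V} := by
    ext : 2
    exact LinearMap.ext fun x => Matrix.add_mulVec U V x

/-- Column vectors over `A` and over `Aᵐᵒᵖ` are the same right `A`-module. -/
def columnEquiv (n : ℕ) : (Fin n → A) ≃ₗ[Aᵐᵒᵖ] (Fin n → Aᵐᵒᵖ) where
  toFun x i := MulOpposite.op (x i)
  invFun x i := MulOpposite.unop (x i)
  map_add' _ _ := rfl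
  map_smul' _ _ := rfl
  left_inv _ := rfl
  right_inv _ := rfl

lemma exists_matLin_eq {m n : ℕ} (g : (Fin m → A) →ₗ[Aᵐᵒᵖ] (Fin n → A)) :
    ∃ U : Matrix (Fin n) (Fin m) A, matLin U = g := by
  obtain ⟨U, hU⟩ := (MatObj.toMod A).map_surjective
    (ObjectProperty.homMk (ModuleCat.ofHom g) :
      (MatObj.toMod A).obj ⟨m⟩ ⟶ (MatObj.toMod A).obj ⟨n⟩)
  exact ⟨U, congrArg (fun k => k.hom.hom) hU⟩

lemma exists_comp_matLin_eq {m n : ℕ} {M : Type*} [AddCommGroup M] [Module Aᵐᵒᵖ M]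
    {p : (Fin n → A) →ₗ[Aᵐᵒᵖ] M} {g : (Fin m → A) →ₗ[Aᵐᵒᵖ] M}
    (h : LinearMap.range g ≤ LinearMap.range p) :
    ∃ U : Matrix (Fin n) (Fin m) A, p ∘ₗ matLin U = g := by
  have : Module.Projective Aᵐᵒᵖ (Fin m → A) := .of_equiv' (columnEquiv m).symm
  obtain ⟨g', hg'⟩ := Module.projective_lifting_property p.rangeRestrict
    (g.codRestrict (LinearMap.range p) fun x => h ⟨x, rfl⟩) p.surjective_rangeRestrict
  obtain ⟨U, rfl⟩ := exists_matLin_eq g'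
  exact ⟨U, LinearMap.ext fun x => congrArg Subtype.val (LinearMap.congr_fun hg' x)⟩

lemma exists_linearMap_range_eq {M : Type*} [AddCommGroup M] [Module Aᵐᵒᵖ M]
    {N : Submodule Aᵐᵒᵖ M} (hN : N.FG) :
    ∃ (n : ℕ) (g : (Fin n → A) →ₗ[Aᵐᵒᵖ] M), LinearMap.range g = N := by
  obtain ⟨n, g, hg⟩ := (Submodule.fg_iff_exists_fin_linearMap _ _).1 hN
  exact ⟨n, g ∘ₗ (columnEquiv n).toLinearMap, by
    rw [LinearMap.range_comp, LinearEquiv.range, Submodule.map_top, hg]⟩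

/-- `A^m ⟶ A^n ⟶ X ⟶ 0` is exact. -/
structure IsFreePresentation {m n : ℕ} (a : Matrix (Fin n) (Fin m) A) {X : FPMod A}
    (p : (MatObj.toMod A).obj ⟨n⟩ ⟶ X) : Prop where
  exact : Function.Exact (matLin a) p.hom.hom
  surjective : Function.Surjective p.hom.hom

lemma IsFreePresentation.isPresentation {m n : ℕ} {a : Matrix (Fin n) (Fin m) A} {X : FPMod A}
    {p : (MatObj.toMod A).obj ⟨n⟩ ⟶ X} (h : IsFreePresentation a p) :
    IsPresentation (m := ⟨m⟩) (n := ⟨n⟩) (MatObj.toMod A) a p where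
  comp_eq_zero := by
    ext : 2
    exact h.exact.linearMap_comp_eq_zero
  epi := ⟨fun g g' hg => by
    ext x
    obtain ⟨y, rfl⟩ := h.surjective x
    exact congrArg (fun k => k.hom.hom y) hg⟩
  exists_desc g hg := by
    obtain ⟨g', hg'⟩ := Limits.CokernelCofork.IsColimit.desc'
      (ModuleCat.isColimitCokernelCofork (ModuleCat.ofHom (matLin a)) p.hom h.exact h.surjective)
      g.hom (congrArg (fun k => k.hom) hg)
    exact ⟨ObjectProperty.homMk g', ObjectProperty.hom_ext _ hg'⟩
  exists_lift {k} g := by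
    obtain ⟨U, hU⟩ := exists_comp_matLin_eq (p := p.hom.hom) (g := g.hom.hom)
      (le_top.trans (LinearMap.range_eq_top.2 h.surjective).ge)
    refine ⟨U, ?_⟩
    ext : 2
    exact hU
  exists_lift_of_comp_eq_zero {k} V hV := by
    obtain ⟨U, hU⟩ := exists_comp_matLin_eq (p := matLin a) (g := matLin V)
      ((LinearMap.range_le_ker_iff.2 (congrArg (fun k => k.hom.hom) hV)).trans
        h.exact.linearMap_ker_eq.le)
    refine ⟨U, (MatObj.toMod A).map_injective ?_⟩
    rw [Functor.map_comp]
    ext : 2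
    exact hU

lemma exists_isFreePresentation_of_matrix {m n : ℕ} (a : Matrix (Fin n) (Fin m) A) :
    ∃ (X : FPMod A) (p : (MatObj.toMod A).obj ⟨n⟩ ⟶ X), IsFreePresentation a p := by
  have hX : Module.FinitePresentation Aᵐᵒᵖ ((Fin n → A) ⧸ LinearMap.range (matLin a)) :=
    Module.finitePresentation_of_surjective (Submodule.mkQ _) (Submodule.mkQ_surjective _) (by
      rw [Submodule.ker_mkQ]
      exact Submodule.fg_range _)
  exact ⟨⟨ModuleCat.of _ ((Fin n → A) ⧸ LinearMap.range (matLin a)), hX⟩,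
    ObjectProperty.homMk (ModuleCat.ofHom (Submodule.mkQ _)), LinearMap.exact_map_mkQ_range _,
    Submodule.mkQ_surjective _⟩

instance : HasPresentations (MatObj.toMod A) where
  exists_isPresentation a := by
    obtain ⟨X, p, h⟩ := exists_isFreePresentation_of_matrix a
    exact ⟨X, p, h.isPresentation⟩

lemma exists_isFreePresentation (X : FPMod A) : ∃ (m n : ℕ) (a : Matrix (Fin n) (Fin m) A)
    (p : (MatObj.toMod A).obj ⟨n⟩ ⟶ X), IsFreePresentation a p := by
  have : Module.FinitePresentation Aᵐᵒᵖ X.obj := X.property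
  obtain ⟨n, p, hp⟩ := exists_linearMap_range_eq (A := A) (Module.Finite.fg_top (M := X.obj))
  rw [LinearMap.range_eq_top] at hp
  obtain ⟨m, g, hg⟩ := exists_linearMap_range_eq (Module.FinitePresentation.fg_ker p hp)
  obtain ⟨a, rfl⟩ := exists_matLin_eq g
  exact ⟨m, n, a, ObjectProperty.homMk (ModuleCat.ofHom p), LinearMap.exact_iff.2 hg.symm, hp⟩

section FreeDiagram

variable {m n k l : ℕ} {a : Matrix (Fin n) (Fin m) A} {b : Matrix (Fin k) (Fin m) A}
  {c : Matrix (Fin l) (Fin n) A} {d : Matrix (Fin l) (Fin k) A} {X Y : FPMod A} {f : X ⟶ Y}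

lemma FreeDiagram.isFreePresentation_p (D : FreeDiagram a b c d f) : IsFreePresentation a D.p :=
  ⟨D.exact_p, D.surjective_p⟩

lemma FreeDiagram.isFreePresentation_q (D : FreeDiagram a b c d f) : IsFreePresentation d D.q :=
  ⟨D.exact_q, D.surjective_q⟩

lemma exists_freeDiagram (f : X ⟶ Y) :
    ∃ (m n k l : ℕ) (a : Matrix (Fin n) (Fin m) A) (b : Matrix (Fin k) (Fin m) A)
      (c : Matrix (Fin l) (Fin n) A) (d : Matrix (Fin l) (Fin k) A),
      Nonempty (FreeDiagram a b c d f) := by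
  obtain ⟨m, n, a, p, hp⟩ := exists_isFreePresentation X
  obtain ⟨k, l, d, q, hq⟩ := exists_isFreePresentation Y
  obtain ⟨c, hc⟩ := hq.isPresentation.exists_lift (p ≫ f)
  have hac : (MatObj.toMod A).map ((a : MatObj.mk m ⟶ ⟨n⟩) ≫ c) ≫ q = 0 := by
    rw [Functor.map_comp, Category.assoc, hc, reassoc_of% hp.isPresentation.comp_eq_zero,
      Limits.zero_comp]
  obtain ⟨b, hb⟩ := hq.isPresentation.exists_lift_of_comp_eq_zero _ hac
  exact ⟨m, n, k, l, a, b, c, d,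
    ⟨p, q, hp.exact, hp.surjective, hq.exact, hq.surjective, hb.symm, hc.symm⟩⟩

lemma exists_freeDiagram_of_chain {r : ℕ} (u : Matrix (Fin n) (Fin m) A)
    (v : Matrix (Fin r) (Fin n) A) :
    ∃ (X Y : FPMod A) (f : X ⟶ Y), Nonempty (FreeDiagram u 1 v (v * u) f) := by
  obtain ⟨X, p, hp⟩ := exists_isFreePresentation_of_matrix u
  obtain ⟨Y, q, hq⟩ := exists_isFreePresentation_of_matrix (v * u)
  obtain ⟨f, hf⟩ := hp.isPresentation.exists_desc ((MatObj.toMod A).map v ≫ q) (by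
    rw [← Category.assoc, ← Functor.map_comp]
    exact hq.isPresentation.comp_eq_zero)
  exact ⟨X, Y, f, ⟨p, q, hp.exact, hp.surjective, hq.exact, hq.surjective,
    (Matrix.mul_one _).symm, hf⟩⟩

lemma FreeDiagram.isCokernelMap {r : ℕ} {u : Matrix (Fin n) (Fin m) A}
    {v : Matrix (Fin r) (Fin n) A} (D : FreeDiagram u 1 v (v * u) f) :
    (matChain u v).as.IsCokernelMap (MatObj.toMod A) D.p D.q f where
  source := D.isFreePresentation_p.isPresentation
  target := D.isFreePresentation_q.isPresentation
  comm := D.comm_right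

end FreeDiagram

end FreePresentation

section BlockChain

open Limits Matrix

variable {A : Type u} [Ring A]

variable (A) in
/-- `A^(m + n)` as the direct sum of `A^m` and `A^n`. -/
def MatObj.bicone (m n : ℕ) : BinaryBicone (MatObj.mk m : MatObj A) ⟨n⟩ where
  pt := ⟨m + n⟩
  fst := (fromCols (1 : Matrix (Fin m) (Fin m) A) 0).reindex (.refl _) finSumFinEquiv
  snd := (fromCols 0 (1 : Matrix (Fin n) (Fin n) A)).reindex (.refl _) finSumFinEquiv
  inl := (fromRows (1 : Matrix (Fin m) (Fin m) A) 0).reindex finSumFinEquiv (.refl _)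
  inr := (fromRows 0 (1 : Matrix (Fin n) (Fin n) A)).reindex finSumFinEquiv (.refl _)
  inl_fst := by
    change reindex _ _ _ * reindex _ _ _ = (1 : Matrix (Fin m) (Fin m) A)
    simp [reindex_apply, submatrix_mul_equiv, fromCols_mul_fromRows]
  inl_snd := by
    change reindex _ _ _ * reindex _ _ _ = (0 : Matrix (Fin n) (Fin m) A)
    simp [reindex_apply, submatrix_mul_equiv, fromCols_mul_fromRows]
  inr_fst := by
    change reindex _ _ _ * reindex _ _ _ = (0 : Matrix (Fin m) (Fin n) A)
    simp [reindex_apply, submatrix_mul_equiv, fromCols_mul_fromRows]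
  inr_snd := by
    change reindex _ _ _ * reindex _ _ _ = (1 : Matrix (Fin n) (Fin n) A)
    simp [reindex_apply, submatrix_mul_equiv, fromCols_mul_fromRows]

lemma MatObj.isBilimit_bicone (m n : ℕ) : Nonempty (MatObj.bicone A m n).IsBilimit := by
  have h : fromRows (1 : Matrix (Fin m) (Fin m) A) 0 * fromCols (1 : Matrix (Fin m) (Fin m) A) 0 +
      fromRows 0 (1 : Matrix (Fin n) (Fin n) A) * fromCols 0 (1 : Matrix (Fin n) (Fin n) A) =
        1 := by
    rw [fromRows_mul_fromCols, fromRows_mul_fromCols, fromBlocks_add]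
    simp
  exact ⟨isBinaryBilimitOfTotal _ ((congrArg (reindex finSumFinEquiv finSumFinEquiv) h).trans
    (submatrix_one_equiv _))⟩

variable {m n k l : ℕ} (a : Matrix (Fin n) (Fin m) A) (b : Matrix (Fin k) (Fin m) A)
  (c : Matrix (Fin l) (Fin n) A) (d : Matrix (Fin l) (Fin k) A)

lemma blockHom_bicone : blockHom (MatObj.bicone A m k) (MatObj.bicone A n k) a b =
    reindex finSumFinEquiv finSumFinEquiv (fromBlocks a 0 b (-1)) := by
  have h : fromRows (1 : Matrix (Fin n) (Fin n) A) 0 * a *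
        fromCols (1 : Matrix (Fin m) (Fin m) A) (0 : Matrix (Fin m) (Fin k) A) +
      fromRows (0 : Matrix (Fin n) (Fin k) A) (1 : Matrix (Fin k) (Fin k) A) * b *
        fromCols (1 : Matrix (Fin m) (Fin m) A) (0 : Matrix (Fin m) (Fin k) A) -
      fromRows (0 : Matrix (Fin n) (Fin k) A) (1 : Matrix (Fin k) (Fin k) A) *
        fromCols (0 : Matrix (Fin k) (Fin m) A) (1 : Matrix (Fin k) (Fin k) A) =
      fromBlocks a 0 b (-1) := by
    simp only [fromRows_mul]
    ext (i | i) (j | j) <;> simp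
  exact congrArg (reindex finSumFinEquiv finSumFinEquiv) h

lemma rowHom_bicone : rowHom (MatObj.bicone A n k) c d =
    reindex (.refl _) finSumFinEquiv (fromCols c (-d)) := by
  have h : c * fromCols (1 : Matrix (Fin n) (Fin n) A) (0 : Matrix (Fin n) (Fin k) A) -
      d * fromCols (0 : Matrix (Fin k) (Fin n) A) (1 : Matrix (Fin k) (Fin k) A) =
      fromCols c (-d) := by
    rw [mul_fromCols, mul_fromCols]
    ext i (j | j) <;> simp
  exact congrArg (reindex (.refl _) finSumFinEquiv) h

end BlockChain

section RightExact

variable {A : Type u} [Ring A] {F G H F' : FPMod A ⥤ AddCommGrpCat.{u}} {φ : G ⟶ H} {π : H ⟶ F}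
  {π' : H ⟶ F'}

lemma RightExact.comp_eq_zero (h : RightExact φ π) : φ ≫ π = 0 := by
  ext M x
  exact (h M).1.apply_apply_eq_zero x

lemma RightExact.isIso_cokernelDesc (h : RightExact φ π) :
    IsIso (Limits.cokernel.desc φ π h.comp_eq_zero) := by
  have hπ (M : FPMod A) (y : H.obj M) :
      (Limits.cokernel.desc φ π h.comp_eq_zero).app M ((Limits.cokernel.π φ).app M y) =
        π.app M y :=
    congrArg (fun k => k.app M y) (Limits.cokernel.π_desc φ π h.comp_eq_zero)
  have (M : FPMod A) : IsIso ((Limits.cokernel.desc φ π h.comp_eq_zero).app M) := by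
    refine (ConcreteCategory.isIso_iff_bijective _).2 ⟨?_, fun x => ?_⟩
    · refine (injective_iff_map_eq_zero _).2 fun x hx => ?_
      obtain ⟨y, rfl⟩ := (AddCommGrpCat.epi_iff_surjective ((Limits.cokernel.π φ).app M)).1
        inferInstance x
      rw [hπ] at hx
      obtain ⟨z, rfl⟩ := ((h M).1 y).1 hx
      exact congrArg (fun k => k.app M z) (Limits.cokernel.condition φ)
    · obtain ⟨y, rfl⟩ := (h M).2 x
      exact ⟨_, hπ M y⟩
  exact NatIso.isIso_of_isIso_app _

lemma RightExact.nonempty_iso (h : RightExact φ π) (h' : RightExact φ π') :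
    Nonempty (F ≅ F') :=
  have := h.isIso_cokernelDesc
  have := h'.isIso_cokernelDesc
  ⟨(asIso (Limits.cokernel.desc φ π h.comp_eq_zero)).symm ≪≫
    asIso (Limits.cokernel.desc φ π' h'.comp_eq_zero)⟩

end RightExact

section ProjPresentation

variable {A : Type u} [Ring A] {X Y : FPMod A} {f : X ⟶ Y}

lemma ProjPresentation.nonempty_iso {F F' : FPFun A} (h : ProjPresentation f F)
    (h' : ProjPresentation f F') : Nonempty (F ≅ F') := by
  obtain ⟨e⟩ := h.exact.nonempty_iso h'.exact
  exact ⟨(isFPFunctor A).isoMk e⟩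

lemma exists_projPresentation (F : FPFun A) :
    ∃ (X Y : FPMod A) (f : X ⟶ Y), Nonempty (ProjPresentation f F) := by
  obtain ⟨X, Y, φ, π, h⟩ := F.property
  obtain ⟨f, rfl⟩ := preadditiveCoyoneda.map_surjective φ
  exact ⟨X, Y, f.unop, ⟨π, h⟩⟩

lemma Chain3.IsCokernelMap.rightExact {Z : Chain3 (MatObj A)}
    {p : (MatObj.toMod A).obj Z.X₂ ⟶ X} {q : (MatObj.toMod A).obj Z.X₃ ⟶ Y}
    (h : Z.IsCokernelMap (MatObj.toMod A) p q f) :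
    RightExact (homFromMap f) (coyonedaToCohomology p h.source.comp_eq_zero) :=
  fun M => ⟨h.exact M, coyonedaToCohomology_surjective h.source M⟩

lemma isFPFunctor_cohomology (Z : (Adelman (MatObj A))ᵒᵖ) :
    isFPFunctor A ((Adelman.cohomology (MatObj.toMod A)).leftOp.obj Z) := by
  obtain ⟨X, Y, p, q, f, h⟩ := Z.unop.as.exists_isCokernelMap (MatObj.toMod A)
  exact ⟨X, Y, homFromMap f, _, h.rightExact⟩

end ProjPresentation

section Equivalence

variable (A : Type u) [Ring A]

/-- The functor `Adelman.cohomology`, for matrices acting on free modules, with values in finitely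
presented functors. -/
def Adelman.toFPFun : Adelman (MatObj A) ⥤ (FPFun A)ᵒᵖ :=
  ((isFPFunctor A).lift (Adelman.cohomology (MatObj.toMod A)).leftOp
    isFPFunctor_cohomology).rightOp

instance : (Adelman.toFPFun A).Additive :=
  Functor.rightOp_additive _

instance : (Adelman.toFPFun A).Full :=
  Functor.rightOp_full

instance : (Adelman.toFPFun A).Faithful :=
  Functor.rightOp_faithful

variable {A} {X Y : FPMod A} {f : X ⟶ Y}

lemma Chain3.IsCokernelMap.nonempty_projPresentation {Z : Adelman (MatObj A)}
    {p : (MatObj.toMod A).obj Z.as.X₂ ⟶ X} {q : (MatObj.toMod A).obj Z.as.X₃ ⟶ Y}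
    (h : Z.as.IsCokernelMap (MatObj.toMod A) p q f) :
    Nonempty (ProjPresentation f ((Adelman.toFPFun A).obj Z).unop) :=
  ⟨⟨_, h.rightExact⟩⟩

section

variable {m n k l : ℕ} {a : Matrix (Fin n) (Fin m) A} {b : Matrix (Fin k) (Fin m) A}
  {c : Matrix (Fin l) (Fin n) A} {d : Matrix (Fin l) (Fin k) A}

lemma FreeDiagram.isCokernelMap_blockChain (D : FreeDiagram a b c d f) :
    (blockChain a b c d).as.IsCokernelMap (MatObj.toMod A)
      ((MatObj.toMod A).map (MatObj.bicone A n k).fst ≫ D.p) D.q f := by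
  obtain ⟨hT⟩ := MatObj.isBilimit_bicone (A := A) n k
  have h := Chain3.IsCokernelMap.block (S := MatObj.bicone A m k) hT
    D.isFreePresentation_p.isPresentation D.isFreePresentation_q.isPresentation D.comm_left
    D.comm_right
  rwa [blockHom_bicone, rowHom_bicone] at h

lemma nonempty_obj_blockChain_iso {F : FPFun A} (hF : ProjPresentation f F)
    (D : FreeDiagram a b c d f) :
    Nonempty ((Adelman.toFPFun A).obj (blockChain a b c d) ≅ op F) := by
  obtain ⟨h⟩ := D.isCokernelMap_blockChain.nonempty_projPresentation
  obtain ⟨e⟩ := hF.nonempty_iso h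
  exact ⟨e.op⟩

end

instance : (Adelman.toFPFun A).EssSurj where
  mem_essImage F := by
    obtain ⟨X, Y, f, ⟨h⟩⟩ := exists_projPresentation F.unop
    obtain ⟨m, n, k, l, a, b, c, d, ⟨D⟩⟩ := exists_freeDiagram f
    exact ⟨blockChain a b c d, nonempty_obj_blockChain_iso h D⟩

instance : (Adelman.toFPFun A).IsEquivalence where

variable (A) in
/-- The cohomology functor of the chain `0 ⟶ A^n ⟶ 0` is `Hom(A^n, -)`. -/
def toAdelmanCompToFPFunIso :
    MatObj.toAdelman A ⋙ Adelman.toFPFun A ≅ MatObj.toMod A ⋙ FPMod.toFPFun A :=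
  NatIso.ofComponents
    (fun X => ((isFPFunctor A).isoMk (X := ((FPMod.toFPFun A).obj ((MatObj.toMod A).obj X)).unop)
      (Y := ((Adelman.toFPFun A).obj ((MatObj.toAdelman A).obj X)).unop)
      (@asIso _ _ _ _ _ (isIso_coyonedaToCohomology_id (P := MatObj.toMod A)
        (Z := (MatObj.toChain A).obj X) (Functor.map_zero _ _ _) (Functor.map_zero _ _ _)))).op)
    (fun U => Quiver.Hom.unop_inj <| ObjectProperty.hom_ext _ <|
      coyonedaToCohomology_naturality ((MatObj.toChain A).map U)
        ((Category.comp_id _).trans (Functor.map_zero _ _ _))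
        ((Category.comp_id _).trans (Functor.map_zero _ _ _))
        ((Category.comp_id _).trans (Category.id_comp _).symm))

end Equivalence

end

theorem theorem2p7 (A : Type u) [Ring A] :
    -- every finitely presented functor and every map in `mod-A` has presentations as required
    (∀ F : FPFun A, ∃ (X Y : FPMod A) (f : X ⟶ Y), Nonempty (ProjPresentation f F)) ∧
    (∀ (X Y : FPMod A) (f : X ⟶ Y), ∃ (m n k l : ℕ) (a : Matrix (Fin n) (Fin m) A)
      (b : Matrix (Fin k) (Fin m) A) (c : Matrix (Fin l) (Fin n) A) (d : Matrix (Fin l) (Fin k) A),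
      Nonempty (FreeDiagram a b c d f)) ∧
    (∀ (m n r : ℕ) (u : Matrix (Fin n) (Fin m) A) (v : Matrix (Fin r) (Fin n) A),
      ∃ (X Y : FPMod A) (f : X ⟶ Y), Nonempty (FreeDiagram u 1 v (v * u) f)) ∧
    ∃ e : (FPFun A)ᵒᵖ ≌ Adelman (MatObj A),
      -- the equivalences are additive and compatible with the embeddings of `A`
      e.functor.Additive ∧ e.inverse.Additive ∧
      Nonempty (ringToFPFun A ⋙ e.functor ≅ ringToAdelman A) ∧
      Nonempty (ringToAdelman A ⋙ e.inverse ≅ ringToFPFun A) ∧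
      -- the formula for `e.functor`
      (∀ (F : FPFun A) (X Y : FPMod A) (f : X ⟶ Y) (_ : ProjPresentation f F)
        (m n k l : ℕ) (a : Matrix (Fin n) (Fin m) A) (b : Matrix (Fin k) (Fin m) A)
        (c : Matrix (Fin l) (Fin n) A) (d : Matrix (Fin l) (Fin k) A) (_ : FreeDiagram a b c d f),
        Nonempty (e.functor.obj (op F) ≅ blockChain a b c d)) ∧
      -- the formula for `e.inverse`
      (∀ (m n r : ℕ) (u : Matrix (Fin n) (Fin m) A) (v : Matrix (Fin r) (Fin n) A)
        (X Y : FPMod A) (f : X ⟶ Y) (_ : FreeDiagram u 1 v (v * u) f),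
        Nonempty (ProjPresentation f (e.inverse.obj (matChain u v)).unop)) := by
  refine ⟨exists_projPresentation, fun _ _ => exists_freeDiagram,
    fun _ _ _ => exists_freeDiagram_of_chain, ?_⟩
  let E := (Adelman.toFPFun A).asEquivalence
  have hE : E.functor.Additive := inferInstanceAs (Adelman.toFPFun A).Additive
  let η : ringToAdelman A ⋙ E.functor ≅ ringToFPFun A :=
    Functor.isoWhiskerLeft (ringToMat A) (toAdelmanCompToFPFunIso A)
  refine ⟨E.symm, E.inverse_additive, hE, ⟨?_⟩, ⟨η⟩, ?_, ?_⟩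
  · exact Functor.isoWhiskerRight η.symm E.inverse ≪≫
      Functor.isoWhiskerLeft (ringToAdelman A) E.unitIso.symm ≪≫ (ringToAdelman A).rightUnitor
  · intro F X Y f hF m n k l a b c d D
    obtain ⟨i⟩ := nonempty_obj_blockChain_iso hF D
    exact ⟨E.inverse.mapIso i.symm ≪≫ (E.unitIso.app _).symm⟩
  · intro m n r u v X Y f D
    exact D.isCokernelMap.nonempty_projPresentation
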